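/- Let $G_3$ be the simply connected nilpotent Lie group whose left-invariant $1$-forms have a basis $e^1,\dots,e^6$ with $$de^i=0\ (1\le i\le 4),\qquad de^5=e^1\wedge e^2,\qquad de^6=e^1\wedge e^5+e^3\wedge e^4 .$$ Let $\Gamma\subset G_3$ be a discrete subgroup with compact quotient $M_3=\Gamma\backslash G_3$, and give $M_3$ the orientation $e^1\wedge\cdots\wedge e^6$ and the metric $g=\sum_{i=1}^6 e^i\otimes e^i$. A tensor field on $M_3$ is called invariant if its pull-back to $G_3$ is left-invariant. Let $\mathcal Z$ be the set of all invariant almost complex structures $J$ on $M_3$ that are orthogonal with respect to $g$ and induce the given orientation; put $\omega(X,Y)=g(JX,Y)$, and let $\nabla$ be the Levi-Civita connection of $g$. At each point let $\mathcal W$ be the space of covariant $3$-tensors $\alpha$ on the tangent space with $\alpha(x,y,z)=-\alpha(x,z,y)=-\alpha(x,Jy,Jz)$, and let $\mathcal W=\mathcal W_1\oplus\mathcal W_2\oplus\mathcal W_3\oplus\mathcal W_4$ be the Gray--Hervella decomposition, that is, - $\mathcal W_1=\{\alpha\in\mathcal W:\alpha(x,x,z)=0\}$, - $\mathcal W_2=\{\alpha\in\mathcal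 W:\alpha(x,y,z)+\alpha(y,z,x)+\alpha(z,x,y)=0\}$, - $\mathcal W_3=\{\alpha\in\mathcal W:\alpha(Jx,Jy,z)=\alpha(x,y,z),\ \sum_i\alpha(b_i,b_i,z)=0\}$, where $(b_i)$ is an orthonormal basis, - $\mathcal W_4=\{\alpha:\alpha(x,y,z)=g(x,y)\theta(z)-g(x,z)\theta(y)-g(x,Jy)\theta(Jz)+g(x,Jz)\theta(Jy)\text{ for some covector }\theta\}$. For distinct $i,j,\dots\in\{1,2,3,4\}$ let $\mathcal Z_{ij\cdots}$ be the set of all $J\in\mathcal Z$ for which $\nabla\omega$ lies in $\mathcal W_i\oplus\mathcal W_j\oplus\cdots$ at every point. Then the classes $$\mathcal Z_1,\ \mathcal Z_2,\ \mathcal Z_3,\ \mathcal Z_4,\ \mathcal Z_{12},\ \mathcal Z_{13},\ \mathcal Z_{14},\ \mathcal Z_{34},\ \mathcal Z_{134}$$ are all empty. In particular, for either orientation, no invariant $g$-orthogonal almost complex structure on $M_3$ is integrable (there are no compatible invariant complex structures), and none has a closed fundamental $2$-form $\omega$ (there are no compatible invariant symplectic structures). -/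

import Mathlib

open scoped ContDiff

noncomputable section

/-! ### The Lie group `G₃`

As a manifold `G₃` is `ℝ⁶`, with coordinates `x₀, …, x₅`. Every tangent space is identified with
`ℝ⁶` through the coordinate fields. -/

/-- The coordinate space `ℝ⁶`, also used as the tangent space at each of its points. -/
abbrev E6 : Type := Fin 6 → ℝ

/-- The group law of `G₃` in coordinates. -/
def g3Mul (a x : E6) : E6 :=
  ![a 0 + x 0, a 1 + x 1, a 2 + x 2, a 3 + x 3,
    a 4 + x 4 - a 0 * x 1,
    a 5 + x 5 - a 0 * x 4 + (a 0) ^ 2 / 2 * x 1 - a 2 * x 3]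

/-- The simply connected nilpotent Lie group `G₃`. -/
def G3 : Type := E6

instance : TopologicalSpace G3 := inferInstanceAs (TopologicalSpace E6)

instance : Mul G3 := ⟨g3Mul⟩

instance : One G3 := ⟨(0 : E6)⟩

instance : Inv G3 :=
  ⟨fun a : E6 => (![-a 0, -a 1, -a 2, -a 3, -a 4 - a 0 * a 1,
    -a 5 - a 0 * a 4 - (a 0) ^ 2 / 2 * a 1 - a 2 * a 3] : E6)⟩

instance : Group G3 :=
  Group.ofLeftAxioms
    (by
      intro a b c
      change g3Mul (g3Mul a b) c = g3Mul a (g3Mul b c)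
      ext i
      fin_cases i <;> simp [g3Mul] <;> ring)
    (by
      intro a
      change g3Mul (0 : E6) a = a
      ext i
      fin_cases i <;> simp [g3Mul])
    (by
      intro a
      change g3Mul (![-a 0, -a 1, -a 2, -a 3, -a 4 - a 0 * a 1,
        -a 5 - a 0 * a 4 - (a 0) ^ 2 / 2 * a 1 - a 2 * a 3] : E6) a = (0 : E6)
      ext i
      fin_cases i <;> simp [g3Mul] <;> ring)

/-- Left translation by `a`, in coordinates. -/
def leftTranslation (a : G3) : E6 → E6 := fun p => a * (show G3 from p)

/-- The partial derivative `∂f/∂xᵢ` at `p`. -/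
def partialDeriv (i : Fin 6) (f : E6 → ℝ) (p : E6) : ℝ := fderiv ℝ f p (Pi.single i 1)

/-- The coframe `e¹, …, e⁶` of `G₃`: the row `k` of the matrix `coframe p` holds the components of
the one-form `eᵏ⁺¹` at `p` with respect to `dx₀, …, dx₅`. -/
def coframe (p : E6) : Matrix (Fin 6) (Fin 6) ℝ :=
  !![1, 0, 0, 0, 0, 0;
     0, 1, 0, 0, 0, 0;
     0, 0, 1, 0, 0, 0;
     0, 0, 0, 1, 0, 0;
     0, p 0, 0, 0, 1, 0;
     0, (p 0) ^ 2 / 2, 0, p 2, p 0, 1]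

theorem partialDeriv_const (i : Fin 6) (c : ℝ) (p : E6) : partialDeriv i (fun _ => c) p = 0 := by
  simp [partialDeriv]

theorem partialDeriv_coord (i j : Fin 6) (p : E6) :
    partialDeriv i (fun q => q j) p = if i = j then 1 else 0 := by
  have h : HasFDerivAt (fun q : E6 => q j) (ContinuousLinearMap.proj (R := ℝ) j) p :=
    (ContinuousLinearMap.proj (R := ℝ) (φ := fun _ : Fin 6 => ℝ) j).hasFDerivAt
  simp [partialDeriv, h.fderiv, Pi.single_apply, eq_comm]

theorem partialDeriv_coord_sq (i j : Fin 6) (p : E6) :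
    partialDeriv i (fun q => (q j) ^ 2 / 2) p = if i = j then p j else 0 := by
  have h : HasFDerivAt (fun q : E6 => q j) (ContinuousLinearMap.proj (R := ℝ) j) p :=
    (ContinuousLinearMap.proj (R := ℝ) (φ := fun _ : Fin 6 => ℝ) j).hasFDerivAt
  have h2 : HasFDerivAt (fun q : E6 => (q j) ^ 2 / 2)
      ((p j) • (ContinuousLinearMap.proj (R := ℝ) (φ := fun _ : Fin 6 => ℝ) j)) p := by
    have h3 := (h.pow 2).mul_const (1 / 2 : ℝ)
    have e : (fun q : E6 => (q j) ^ 2 / 2) = fun q : E6 => (q j) ^ 2 * (1 / 2) := by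
      ext q; ring
    rw [e]
    refine h3.congr_fderiv ?_
    ext v
    simp
    ring
  simp [partialDeriv, h2.fderiv, Pi.single_apply, eq_comm]

/-- The structure equations `deⁱ = 0` (`i ≤ 4`), `de⁵ = e¹ ∧ e²`, `de⁶ = e¹ ∧ e⁵ + e³ ∧ e⁴`,
in components: `(dα)ᵢⱼ = ∂ᵢαⱼ - ∂ⱼαᵢ` and `(α ∧ β)ᵢⱼ = αᵢβⱼ - αⱼβᵢ`. -/
theorem coframe_structure (k i j : Fin 6) (p : E6) :
    partialDeriv i (fun q => coframe q k j) p - partialDeriv j (fun q => coframe q k i) p =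
      (![0, 0, 0, 0,
        coframe p 0 i * coframe p 1 j - coframe p 0 j * coframe p 1 i,
        (coframe p 0 i * coframe p 4 j - coframe p 0 j * coframe p 4 i)
          + (coframe p 2 i * coframe p 3 j - coframe p 2 j * coframe p 3 i)] : Fin 6 → ℝ) k := by
  fin_cases k <;> fin_cases i <;> fin_cases j <;>
    simp [coframe, partialDeriv_const, partialDeriv_coord, partialDeriv_coord_sq]

/-- The derivative of the left translation by `a`. -/
def leftDeriv (a : E6) : Matrix (Fin 6) (Fin 6) ℝ :=
  !![1, 0, 0, 0, 0, 0;
     0, 1, 0, 0, 0, 0;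
     0, 0, 1, 0, 0, 0;
     0, 0, 0, 1, 0, 0;
     0, -a 0, 0, 0, 1, 0;
     0, (a 0) ^ 2 / 2, 0, -a 2, -a 0, 1]

theorem fderiv_leftTranslation (a : G3) (p v : E6) :
    fderiv ℝ (leftTranslation a) p v = (leftDeriv a).mulVec v := by
  have e : leftTranslation a = fun p => (leftDeriv a).mulVecLin.toContinuousLinearMap p
      + (show E6 from a) := by
    ext q i
    change g3Mul a q i = (leftDeriv a).mulVec q i + (show E6 from a) i
    fin_cases i <;> simp [g3Mul, leftDeriv, Matrix.mulVec, dotProduct, Fin.sum_univ_six] <;> ring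
  rw [e, ((leftDeriv a).mulVecLin.toContinuousLinearMap.hasFDerivAt.add_const _).fderiv]
  rfl

/-- The coframe is invariant under left translations. -/
theorem coframe_leftTranslation (a : G3) (p v : E6) :
    (coframe (leftTranslation a p)).mulVec (fderiv ℝ (leftTranslation a) p v) =
      (coframe p).mulVec v := by
  rw [fderiv_leftTranslation]
  change (coframe (g3Mul a p)).mulVec _ = _
  ext i
  fin_cases i <;>
    simp [g3Mul, coframe, leftDeriv, Matrix.mulVec, dotProduct, Fin.sum_univ_six] <;> ring

/-- The matrix `(gᵢⱼ)` of the invariant metric `g = ∑ eᵏ ⊗ eᵏ` in coordinates. -/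
def metric (p : E6) : Matrix (Fin 6) (Fin 6) ℝ := (coframe p).transpose * coframe p

theorem det_coframe (p : E6) : (coframe p).det = 1 := by
  have h : (coframe p).BlockTriangular OrderDual.toDual := by
    intro i j h
    have h' : i < j := h
    clear h
    revert h'
    fin_cases i <;> fin_cases j <;> simp [coframe]
  rw [Matrix.det_of_isLowerTriangular _ h]
  simp [Fin.prod_univ_six, coframe]

theorem det_metric (p : E6) : (metric p).det = 1 := by
  simp [metric, det_coframe]

/-- The volume form `υ = e¹ ∧ ⋯ ∧ e⁶`, evaluated on six tangent vectors. -/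
def volumeForm (p : E6) (v : Fin 6 → E6) : ℝ :=
  (Matrix.of fun i j : Fin 6 => (coframe p).mulVec (v j) i).det

/-- The Christoffel symbols `Γᵏᵢⱼ = ½ ∑ₗ gᵏˡ (∂ᵢ gⱼₗ + ∂ⱼ gᵢₗ - ∂ₗ gᵢⱼ)` of the Levi-Civita
connection of `g`. -/
def christoffel (p : E6) (k i j : Fin 6) : ℝ :=
  (1 / 2) * ∑ l : Fin 6, (metric p)⁻¹ k l *
    (partialDeriv i (fun q => metric q j l) p + partialDeriv j (fun q => metric q i l) p
      - partialDeriv l (fun q => metric q i j) p)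

/-! ### Almost Hermitian structures and the Gray-Hervella classes -/

/-- Covariant tensors of degree three on a real vector space. -/
abbrev Tensor3 (V : Type*) [AddCommGroup V] [Module ℝ V] : Type _ :=
  V →ₗ[ℝ] V →ₗ[ℝ] V →ₗ[ℝ] ℝ

section GrayHervella

variable {V : Type*} [AddCommGroup V] [Module ℝ V]

/-- The space `𝒲` of tensors with the symmetries of `∇ω`:
`α(x, y, z) = -α(x, z, y) = -α(x, Jy, Jz)`. -/
def ghTotal (J : V →ₗ[ℝ] V) : Submodule ℝ (Tensor3 V) where
  carrier := {α | ∀ x y z, α x y z = -α x z y ∧ α x y z = -α x (J y) (J z)}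
  add_mem' := by
    intro α β hα hβ x y z
    have h := hα x y z
    have h' := hβ x y z
    simp only [LinearMap.add_apply]
    constructor <;> linarith [h.1, h.2, h'.1, h'.2]
  zero_mem' := by simp
  smul_mem' := by
    intro c α hα x y z
    simp only [LinearMap.smul_apply, smul_eq_mul, ← mul_neg]
    exact ⟨congrArg _ (hα x y z).1, congrArg _ (hα x y z).2⟩

/-- `𝒲₁`: the tensors in `𝒲` with `α(x, x, z) = 0`. -/
def ghOne (J : V →ₗ[ℝ] V) : Submodule ℝ (Tensor3 V) where
  carrier := {α | α ∈ ghTotal J ∧ ∀ x z, α x x z = 0}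
  add_mem' := by
    intro α β hα hβ
    exact ⟨add_mem hα.1 hβ.1, fun x z => by simp [hα.2 x z, hβ.2 x z]⟩
  zero_mem' := ⟨zero_mem _, by simp⟩
  smul_mem' := by
    intro c α hα
    exact ⟨Submodule.smul_mem _ c hα.1, fun x z => by simp [hα.2 x z]⟩

/-- `𝒲₂`: the tensors in `𝒲` whose cyclic sum vanishes. -/
def ghTwo (J : V →ₗ[ℝ] V) : Submodule ℝ (Tensor3 V) where
  carrier := {α | α ∈ ghTotal J ∧ ∀ x y z, α x y z + α y z x + α z x y = 0}
  add_mem' := by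
    intro α β hα hβ
    refine ⟨add_mem hα.1 hβ.1, fun x y z => ?_⟩
    simp only [LinearMap.add_apply]
    linarith [hα.2 x y z, hβ.2 x y z]
  zero_mem' := ⟨zero_mem _, by simp⟩
  smul_mem' := by
    intro c α hα
    refine ⟨Submodule.smul_mem _ c hα.1, fun x y z => ?_⟩
    simp only [LinearMap.smul_apply, smul_eq_mul, ← mul_add, hα.2 x y z, mul_zero]

/-- `𝒲₃`: the tensors in `𝒲` with `α(Jx, Jy, z) = α(x, y, z)` and `∑ᵢ α(bᵢ, bᵢ, z) = 0`, where
`b` is any `g`-orthonormal basis. -/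
def ghThree (g : V →ₗ[ℝ] V →ₗ[ℝ] ℝ) (J : V →ₗ[ℝ] V) : Submodule ℝ (Tensor3 V) where
  carrier := {α | α ∈ ghTotal J ∧ (∀ x y z, α (J x) (J y) z = α x y z) ∧
    ∀ (n : ℕ) (b : Module.Basis (Fin n) ℝ V),
      (∀ i j, g (b i) (b j) = if i = j then 1 else 0) → ∀ z, ∑ i, α (b i) (b i) z = 0}
  add_mem' := by
    intro α β hα hβ
    refine ⟨add_mem hα.1 hβ.1, fun x y z => ?_, fun n b hb z => ?_⟩
    · simp [hα.2.1 x y z, hβ.2.1 x y z]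
    · simp [Finset.sum_add_distrib, hα.2.2 n b hb z, hβ.2.2 n b hb z]
  zero_mem' := ⟨zero_mem _, by simp, by simp⟩
  smul_mem' := by
    intro c α hα
    refine ⟨Submodule.smul_mem _ c hα.1, fun x y z => ?_, fun n b hb z => ?_⟩
    · simp [hα.2.1 x y z]
    · simp [← Finset.mul_sum, hα.2.2 n b hb z]

/-- `𝒲₄`: the tensors of the form
`α(x, y, z) = g(x, y) θ(z) - g(x, z) θ(y) - g(x, Jy) θ(Jz) + g(x, Jz) θ(Jy)` for a covector `θ`. -/
def ghFour (g : V →ₗ[ℝ] V →ₗ[ℝ] ℝ) (J : V →ₗ[ℝ] V) : Submodule ℝ (Tensor3 V) where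
  carrier := {α | ∃ θ : V →ₗ[ℝ] ℝ, ∀ x y z,
    α x y z = g x y * θ z - g x z * θ y - g x (J y) * θ (J z) + g x (J z) * θ (J y)}
  add_mem' := by
    rintro α β ⟨θ, hθ⟩ ⟨η, hη⟩
    refine ⟨θ + η, fun x y z => ?_⟩
    simp only [LinearMap.add_apply, hθ, hη]
    ring
  zero_mem' := ⟨0, by simp⟩
  smul_mem' := by
    rintro c α ⟨θ, hθ⟩
    refine ⟨c • θ, fun x y z => ?_⟩
    simp only [LinearMap.smul_apply, smul_eq_mul, hθ]
    ring

/-- The four Gray-Hervella spaces `𝒲₁, 𝒲₂, 𝒲₃, 𝒲₄` of `(V, g, J)`, indexed by `1, 2, 3, 4`. -/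
def ghSpace (g : V →ₗ[ℝ] V →ₗ[ℝ] ℝ) (J : V →ₗ[ℝ] V) : ℕ → Submodule ℝ (Tensor3 V)
  | 1 => ghOne J
  | 2 => ghTwo J
  | 3 => ghThree g J
  | 4 => ghFour g J
  | _ => ⊥

end GrayHervella

/-- A field of endomorphisms of the tangent spaces of `G₃`, given by its matrices with respect to
the coordinate fields. -/
abbrev EndField : Type := E6 → Matrix (Fin 6) (Fin 6) ℝ

/-- The components `ωᵢⱼ = g(J∂ᵢ, ∂ⱼ)` of the fundamental two-form `ω(X, Y) = g(JX, Y)`. -/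
def fundamentalForm (J : EndField) (p : E6) : Matrix (Fin 6) (Fin 6) ℝ :=
  (J p).transpose * metric p

/-- The components `(∇ω)ᵢⱼₖ = ∂ᵢ ωⱼₖ - ∑ₗ Γˡᵢⱼ ωₗₖ - ∑ₗ Γˡᵢₖ ωⱼₗ` of the covariant derivative of the
fundamental form; `i` is the direction of differentiation. -/
def nablaOmega (J : EndField) (p : E6) (i j k : Fin 6) : ℝ :=
  partialDeriv i (fun q => fundamentalForm J q j k) p
    - ∑ l : Fin 6, christoffel p l i j * fundamentalForm J p l k
    - ∑ l : Fin 6, christoffel p l i k * fundamentalForm J p j l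

/-- The trilinear map with components `T`. -/
def tensorOfComponents (T : Fin 6 → Fin 6 → Fin 6 → ℝ) : Tensor3 E6 :=
  ∑ i : Fin 6, ∑ j : Fin 6, ∑ k : Fin 6, T i j k •
    (LinearMap.proj i : E6 →ₗ[ℝ] ℝ).smulRight
      ((LinearMap.proj j : E6 →ₗ[ℝ] ℝ).smulRight (LinearMap.proj k : E6 →ₗ[ℝ] ℝ))

theorem tensorOfComponents_apply (T : Fin 6 → Fin 6 → Fin 6 → ℝ) (u v w : E6) :
    tensorOfComponents T u v w =
      ∑ i : Fin 6, ∑ j : Fin 6, ∑ k : Fin 6, T i j k * (u i * (v j * w k)) := by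
  simp [tensorOfComponents]

/-- The metric at `p` as a bilinear form. -/
def metricForm (p : E6) : E6 →ₗ[ℝ] E6 →ₗ[ℝ] ℝ := Matrix.toLinearMap₂' ℝ (metric p)

theorem metricForm_apply (p u v : E6) :
    metricForm p u v = dotProduct ((coframe p).mulVec u) ((coframe p).mulVec v) := by
  rw [metricForm, Matrix.toLinearMap₂'_apply', metric, ← Matrix.mulVec_mulVec,
    Matrix.dotProduct_mulVec, Matrix.vecMul_transpose]

/-- `J` is invariant under left translations by the elements of the subgroup `H`. -/
def InvariantUnder (H : Subgroup G3) (J : EndField) : Prop :=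
  ∀ a ∈ H, ∀ p v : E6,
    (J (leftTranslation a p)).mulVec (fderiv ℝ (leftTranslation a) p v) =
      fderiv ℝ (leftTranslation a) p ((J p).mulVec v)

/-- `J` is (the lift to `G₃` of) an invariant almost complex structure on the nilmanifold `Γ \ G₃`
that is orthogonal with respect to `g`. A field of endomorphisms on `Γ \ G₃` is the same as a
`Γ`-invariant one on `G₃`; it is called invariant if its lift is invariant under all of `G₃`. -/
structure IsInvariantAlmostHermitian (Γ : Subgroup G3) (J : EndField) : Prop where
  descends : InvariantUnder Γ J
  invariant : InvariantUnder ⊤ J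
  sq_eq_neg_one : ∀ p, J p * J p = -1
  orthogonal : ∀ p u v, metricForm p ((J p).mulVec u) ((J p).mulVec v) = metricForm p u v

/-- The orientation induced by `J` is that of `e¹ ∧ ⋯ ∧ e⁶`: some basis of the form
`u, Ju, v, Jv, w, Jw` of each tangent space is positively oriented. -/
def IsPositivelyOriented (J : EndField) : Prop :=
  ∀ p, ∃ u v w : E6,
    0 < volumeForm p ![u, (J p).mulVec u, v, (J p).mulVec v, w, (J p).mulVec w]

/-- The set `𝒵` of positively oriented invariant orthogonal almost complex structures
on `Γ \ G₃`. -/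
def orthogonalACS (Γ : Subgroup G3) : Set EndField :=
  {J | IsInvariantAlmostHermitian Γ J ∧ IsPositivelyOriented J}

/-- The class `𝒵_S`: those `J ∈ 𝒵` for which `∇ω` lies everywhere in the sum of the spaces `𝒲ᵢ`,
`i ∈ S`. -/
def ghClass (Γ : Subgroup G3) (S : Finset ℕ) : Set EndField :=
  {J | J ∈ orthogonalACS Γ ∧
    ∀ p, tensorOfComponents (nablaOmega J p) ∈
      ⨆ i ∈ S, ghSpace (metricForm p) (J p).mulVecLin i}

/-- The almost complex structure `J` is integrable (a complex structure): its Nijenhuis tensor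
`[JX, JY] - J[JX, Y] - J[X, JY] - [X, Y]` vanishes. -/
def IsComplexStructure (J : EndField) : Prop :=
  ∀ X Y : E6 → E6, ContDiff ℝ ∞ X → ContDiff ℝ ∞ Y → ∀ p,
    VectorField.lieBracket ℝ (fun q => (J q).mulVec (X q)) (fun q => (J q).mulVec (Y q)) p
      - (J p).mulVec (VectorField.lieBracket ℝ (fun q => (J q).mulVec (X q)) Y p)
      - (J p).mulVec (VectorField.lieBracket ℝ X (fun q => (J q).mulVec (Y q)) p)
      - VectorField.lieBracket ℝ X Y p = 0

/-- The fundamental form of `J` is closed (hence symplectic):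
`(dω)ᵢⱼₖ = ∂ᵢ ωⱼₖ + ∂ⱼ ωₖᵢ + ∂ₖ ωᵢⱼ = 0`. -/
def IsSymplecticStructure (J : EndField) : Prop :=
  ∀ p i j k, partialDeriv i (fun q => fundamentalForm J q j k) p
    + partialDeriv j (fun q => fundamentalForm J q k i) p
    + partialDeriv k (fun q => fundamentalForm J q i j) p = 0

end

noncomputable section

/-! ### Components of tensors -/

/-! By invariance everything can be tested at the identity, where the coframe is the identity matrix
and `J 0` is a skew orthogonal matrix with square `-1`. All the geometry is then encoded in
`structureForm`, S(x,y,z) = -g([x,y],z), and Koszul's formula writes ∇ω through S and J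
(`nablaOmega_tensor_zero`). Below, e_1, …, e_6 is the standard basis, so e_i has index i - 1 in the
code.

The nine classes lie in the two sums over {1,3,4} and {1,2}, and each sum satisfies a linear
condition. On 𝒲₁⊕𝒲₃⊕𝒲₄ one has α(x,x,z) = α(Jx,Jx,z); for ∇ω this says g(N(x,z),Jx) = 0, i.e. the
Nijenhuis tensor N is totally skew. On 𝒲₁⊕𝒲₂ the cyclic sum of α, which for ∇ω is dω, has type
(3,0)+(0,3). Integrability (N = 0) and dω = 0 are special cases of these two conditions.

Both conditions fail because e_6 is central. If N is skew, testing on x = e_6 and comparing norms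
forces Je_6 = ±e_2; then z = e_2 forces Je_1 = 0 (`not_nijenhuis_skew`). If dω has type (3,0)+(0,3),
then e_6 and Je_6 both lie in its kernel, and evaluating dω(Je_6, ·, ·) shows that the unit vector
Je_6 has squared norm at least 2 (`not_cyclicForm_antiInvariant`). -/

theorem tensorOfComponents_swap_left (T : Fin 6 → Fin 6 → Fin 6 → ℝ) (x y z : E6) :
    tensorOfComponents (fun i j k => T j i k) x y z = tensorOfComponents T y x z := by
  simp only [tensorOfComponents_apply]
  rw [Finset.sum_comm]
  refine Finset.sum_congr rfl fun i _ => Finset.sum_congr rfl fun j _ =>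
    Finset.sum_congr rfl fun k _ => by ring

theorem tensorOfComponents_swap_right (T : Fin 6 → Fin 6 → Fin 6 → ℝ) (x y z : E6) :
    tensorOfComponents (fun i j k => T i k j) x y z = tensorOfComponents T x z y := by
  simp only [tensorOfComponents_apply]
  refine Finset.sum_congr rfl fun i _ => ?_
  rw [Finset.sum_comm]
  refine Finset.sum_congr rfl fun j _ => Finset.sum_congr rfl fun k _ => by ring

theorem tensorOfComponents_contract (T : Fin 6 → Fin 6 → Fin 6 → ℝ)
    (A : Matrix (Fin 6) (Fin 6) ℝ) (x y z : E6) :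
    tensorOfComponents (fun i j k => ∑ l, T i j l * A l k) x y z =
      tensorOfComponents T x y (A.mulVec z) := by
  simp only [tensorOfComponents_apply]
  refine Finset.sum_congr rfl fun i _ => Finset.sum_congr rfl fun j _ => ?_
  simp only [Matrix.mulVec, dotProduct, Finset.mul_sum, Finset.sum_mul]
  rw [Finset.sum_comm]
  refine Finset.sum_congr rfl fun k _ => Finset.sum_congr rfl fun l _ => by ring

/-! ### Derivatives of the coframe at the identity -/

/-- The derivative `∂ᵢ` of the matrix `coframe` at the identity. -/
def coframeDeriv (i : Fin 6) : Matrix (Fin 6) (Fin 6) ℝ := fun l j =>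
  if (l = 4 ∧ i = 0 ∧ j = 1) ∨ (l = 5 ∧ i = 0 ∧ j = 4) ∨ (l = 5 ∧ i = 2 ∧ j = 3) then 1 else 0

theorem differentiable_coframe (l j : Fin 6) : Differentiable ℝ fun q => coframe q l j := by
  fin_cases l <;> fin_cases j <;> simp [coframe] <;> fun_prop

theorem partialDeriv_coframe_zero (i l j : Fin 6) :
    partialDeriv i (fun q => coframe q l j) 0 = coframeDeriv i l j := by
  fin_cases l <;> fin_cases j <;>
    simp [coframe, partialDeriv_const, partialDeriv_coord, partialDeriv_coord_sq, coframeDeriv]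

theorem coframe_zero : coframe 0 = 1 := by
  ext i j
  fin_cases i <;> fin_cases j <;> simp [coframe]

theorem metric_zero : metric 0 = 1 := by
  simp [metric, coframe_zero]

theorem metricForm_zero (u v : E6) : metricForm 0 u v = dotProduct u v := by
  simp [metricForm_apply, coframe_zero]

/-- Product rule at the identity, where the undifferentiated coframe factors equal 1. It serves both
the metric (`B = 1`) and the fundamental form (`B` the transpose of `J 0`). -/
theorem partialDeriv_invariantForm (B : Matrix (Fin 6) (Fin 6) ℝ) (i j k : Fin 6) :
    partialDeriv i (fun q => ((coframe q).transpose * B * coframe q) j k) 0 =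
      ((coframeDeriv i).transpose * B + B * coframeDeriv i) j k := by
  have hd : ∀ l j, HasFDerivAt (fun q => coframe q l j)
      (fderiv ℝ (fun q => coframe q l j) 0) 0 :=
    fun l j => (differentiable_coframe l j 0).hasFDerivAt
  have hv : ∀ l j, fderiv ℝ (fun q => coframe q l j) 0 (Pi.single i 1) = coframeDeriv i l j :=
    fun l j => partialDeriv_coframe_zero i l j
  have h := HasFDerivAt.fun_sum (u := Finset.univ) fun n _ =>
    (HasFDerivAt.fun_sum (u := Finset.univ) fun m _ =>
      (hd m j).mul_const (B m n)).mul (hd n k)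
  have e : (fun q => ((coframe q).transpose * B * coframe q) j k) =
      fun q => ∑ n, (∑ m, coframe q m j * B m n) * coframe q n k := by
    ext q
    simp [Matrix.mul_apply]
  rw [partialDeriv, e]
  erw [h.fderiv]
  simp [hv, coframe_zero, Matrix.mul_apply, Matrix.one_apply, Finset.sum_add_distrib, mul_comm]
  ring

theorem partialDeriv_metric_zero (i j k : Fin 6) :
    partialDeriv i (fun q => metric q j k) 0 = coframeDeriv i k j + coframeDeriv i j k := by
  have h := partialDeriv_invariantForm 1 i j k
  simpa [metric] using h

theorem christoffel_zero (k i j : Fin 6) :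
    christoffel 0 k i j = (1 / 2) * (coframeDeriv i k j + coframeDeriv i j k
      + coframeDeriv j k i + coframeDeriv j i k - coframeDeriv k j i - coframeDeriv k i j) := by
  simp only [christoffel, metric_zero, inv_one, Matrix.one_apply, partialDeriv_metric_zero]
  simp
  ring

/-- The components `(deˡ)ᵢⱼ` of the differentials of the coframe at the identity. -/
def structureComponents (i j l : Fin 6) : ℝ := coframeDeriv i l j - coframeDeriv j l i

/-- The trilinear form `(x, y, z) ↦ ∑ₖ zₖ deᵏ(x, y)` at the identity, that is
`-g([x, y], z)`. -/
def structureForm : Tensor3 E6 := tensorOfComponents structureComponents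

theorem structureForm_apply (x y z : E6) : structureForm x y z =
    (x 0 * y 1 - x 1 * y 0) * z 4 + (x 0 * y 4 - x 4 * y 0 + x 2 * y 3 - x 3 * y 2) * z 5 := by
  simp [structureForm, tensorOfComponents_apply, structureComponents, coframeDeriv,
    Fin.sum_univ_six]
  ring

/-! ### Invariant almost Hermitian structures at the identity -/

namespace IsInvariantAlmostHermitian

variable {Γ : Subgroup G3} {J : EndField}

/-- Left translation by `p` carries the identity to `p`, so invariance conjugates `J 0` into `J p`.
-/
theorem mul_leftDeriv (h : IsInvariantAlmostHermitian Γ J) (p : E6) :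
    J p * leftDeriv p = leftDeriv p * J 0 := by
  have e : leftTranslation p 0 = p := mul_one (show G3 from p)
  apply Matrix.ext_of_mulVec_single
  intro i
  have h1 := h.invariant p trivial 0 (Pi.single i 1)
  rw [fderiv_leftTranslation p, fderiv_leftTranslation p, e] at h1
  rw [← Matrix.mulVec_mulVec, ← Matrix.mulVec_mulVec]
  exact h1

end IsInvariantAlmostHermitian

theorem coframe_mul_leftDeriv (p : E6) : coframe p * leftDeriv p = 1 := by
  ext i j
  fin_cases i <;> fin_cases j <;>
    (simp [coframe, leftDeriv, Matrix.mul_apply, Fin.sum_univ_six]; try ring)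

namespace IsInvariantAlmostHermitian

variable {Γ : Subgroup G3} {J : EndField}

/-- In the left-invariant frame `J` has constant coefficients, namely those of `J 0`. -/
theorem coframe_mul (h : IsInvariantAlmostHermitian Γ J) (p : E6) :
    coframe p * J p = J 0 * coframe p := by
  have h1 := coframe_mul_leftDeriv p
  have h2 := mul_eq_one_comm.mp h1
  calc coframe p * J p = coframe p * (J p * leftDeriv p) * coframe p := by
        rw [Matrix.mul_assoc, Matrix.mul_assoc, h2, Matrix.mul_one]
    _ = J 0 * coframe p := by
        rw [h.mul_leftDeriv, ← Matrix.mul_assoc, h1, Matrix.one_mul]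

theorem transpose_mul_self (h : IsInvariantAlmostHermitian Γ J) : (J 0).transpose * J 0 = 1 := by
  ext i j
  have h1 := h.orthogonal 0 (Pi.single i 1) (Pi.single j 1)
  rw [metricForm_zero, metricForm_zero] at h1
  simpa [Matrix.mul_apply, dotProduct, Matrix.one_apply, Pi.single_apply, eq_comm] using h1

theorem transpose_eq_neg (h : IsInvariantAlmostHermitian Γ J) : (J 0).transpose = -J 0 := by
  have h1 : (J 0).transpose * J 0 * J 0 = J 0 := by rw [h.transpose_mul_self, Matrix.one_mul]
  rw [Matrix.mul_assoc, h.sq_eq_neg_one, Matrix.mul_neg, Matrix.mul_one] at h1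
  exact neg_eq_iff_eq_neg.mp (by simpa using h1)

theorem apply_swap (h : IsInvariantAlmostHermitian Γ J) (i j : Fin 6) : J 0 i j = -J 0 j i := by
  have := congrFun (congrFun h.transpose_eq_neg j) i
  simpa using this

theorem fundamentalForm_eq (h : IsInvariantAlmostHermitian Γ J) (p : E6) :
    fundamentalForm J p = (coframe p).transpose * (J 0).transpose * coframe p := by
  rw [fundamentalForm, metric, ← Matrix.mul_assoc, ← Matrix.transpose_mul, h.coframe_mul,
    Matrix.transpose_mul]

theorem partialDeriv_fundamentalForm_zero (h : IsInvariantAlmostHermitian Γ J) (i j k : Fin 6) :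
    partialDeriv i (fun q => fundamentalForm J q j k) 0 =
      ∑ l, (coframeDeriv i l k * J 0 l j - coframeDeriv i l j * J 0 l k) := by
  simp_rw [h.fundamentalForm_eq]
  rw [partialDeriv_invariantForm, h.transpose_eq_neg, Matrix.add_apply, Matrix.mul_apply,
    Matrix.mul_apply, ← Finset.sum_add_distrib]
  refine Finset.sum_congr rfl fun l _ => ?_
  rw [Matrix.neg_apply, Matrix.neg_apply, h.apply_swap j l, Matrix.transpose_apply]
  ring

theorem nablaOmega_zero (h : IsInvariantAlmostHermitian Γ J) (i j k : Fin 6) :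
    nablaOmega J 0 i j k =
      (1 / 2) * (-(∑ l, structureComponents i j l * J 0 l k)
        + (∑ l, structureComponents i k l * J 0 l j)
        + (∑ l, structureComponents i l j * J 0 l k)
        + (∑ l, structureComponents j l i * J 0 l k)
        - (∑ l, structureComponents i l k * J 0 l j)
        - ∑ l, structureComponents k l i * J 0 l j) := by
  rw [nablaOmega, h.partialDeriv_fundamentalForm_zero]
  simp only [← Finset.sum_add_distrib, ← Finset.sum_sub_distrib, ← Finset.sum_neg_distrib,
    Finset.mul_sum]
  refine Finset.sum_congr rfl fun l _ => ?_
  rw [christoffel_zero, christoffel_zero, h.fundamentalForm_eq, coframe_zero, h.transpose_eq_neg]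
  simp only [Matrix.transpose_one, Matrix.one_mul, Matrix.mul_one, Matrix.neg_apply,
    structureComponents, h.apply_swap j l]
  ring

/-- This is (∇_x ω)(y,z) = g(∇_x(Jy),z) + g(∇_x y,Jz) on left-invariant fields, with Koszul's
formula 2g(∇_x y,z) = -S(x,y,z) + S(y,z,x) - S(z,x,y) applied to both terms. -/
theorem nablaOmega_tensor_zero (h : IsInvariantAlmostHermitian Γ J) (x y z : E6) :
    tensorOfComponents (nablaOmega J 0) x y z =
      (1 / 2) * (-structureForm x y ((J 0).mulVec z) + structureForm x z ((J 0).mulVec y)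
        + structureForm x ((J 0).mulVec z) y + structureForm y ((J 0).mulVec z) x
        - structureForm x ((J 0).mulVec y) z - structureForm z ((J 0).mulVec y) x) := by
  have h1 : ∀ x y z, tensorOfComponents
      (fun i j k => ∑ l, structureComponents i j l * J 0 l k) x y z =
        structureForm x y ((J 0).mulVec z) :=
    fun x y z => tensorOfComponents_contract _ _ x y z
  have h3 : ∀ x y z, tensorOfComponents
      (fun i j k => ∑ l, structureComponents i l j * J 0 l k) x y z =
        structureForm x ((J 0).mulVec z) y := fun x y z => by
    rw [tensorOfComponents_contract (fun i j l => structureComponents i l j),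
      tensorOfComponents_swap_right structureComponents]
    rfl
  have h4 : ∀ x y z, tensorOfComponents
      (fun i j k => ∑ l, structureComponents j l i * J 0 l k) x y z =
        structureForm y ((J 0).mulVec z) x := fun x y z => by
    rw [tensorOfComponents_swap_left (fun i j k => ∑ l, structureComponents i l j * J 0 l k), h3]
  have h2 := tensorOfComponents_swap_right
    (fun i j k => ∑ l, structureComponents i j l * J 0 l k) x y z
  have h5 := tensorOfComponents_swap_right
    (fun i j k => ∑ l, structureComponents i l j * J 0 l k) x y z
  have h6 := tensorOfComponents_swap_right
    (fun i j k => ∑ l, structureComponents j l i * J 0 l k) x y z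
  rw [h1] at h2
  rw [h3] at h5
  rw [h4] at h6
  rw [← h1, ← h2, ← h3 x y z, ← h4, ← h5, ← h6]
  simp only [tensorOfComponents_apply, h.nablaOmega_zero]
  simp only [Finset.mul_sum, ← Finset.sum_add_distrib, ← Finset.sum_sub_distrib,
    ← Finset.sum_neg_distrib]
  refine Finset.sum_congr rfl fun i _ => Finset.sum_congr rfl fun j _ =>
    Finset.sum_congr rfl fun k _ => ?_
  simp only [Finset.mul_sum, Finset.sum_mul, ← Finset.sum_add_distrib,
    ← Finset.sum_sub_distrib, ← Finset.sum_neg_distrib]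
  refine Finset.sum_congr rfl fun l _ => by ring

theorem mulVec_mulVec (h : IsInvariantAlmostHermitian Γ J) (x : E6) :
    (J 0).mulVec ((J 0).mulVec x) = -x := by
  rw [Matrix.mulVec_mulVec, h.sq_eq_neg_one, Matrix.neg_mulVec, Matrix.one_mulVec]

end IsInvariantAlmostHermitian

theorem structureForm_swap (x y z : E6) : structureForm x y z = -structureForm y x z := by
  simp only [structureForm_apply]
  ring

/-! ### Linear conditions implied by the Gray-Hervella classes -/

section GrayHervella

variable {V : Type*} [AddCommGroup V] [Module ℝ V]

/-- The tensors with `α(x, x, z) = α(Jx, Jx, z)`. -/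
def diagonalInvariant (J : V →ₗ[ℝ] V) : Submodule ℝ (Tensor3 V) where
  carrier := {α | ∀ x z, α x x z = α (J x) (J x) z}
  add_mem' := by
    intro α β hα hβ x z
    simp [hα x z, hβ x z]
  zero_mem' := by simp
  smul_mem' := by
    intro c α hα x z
    simp [hα x z]

/-- The tensors whose cyclic sum `σ` satisfies `σ(Jx, Jy, z) = -σ(x, y, z)`. -/
def cyclicAntiInvariant (J : V →ₗ[ℝ] V) : Submodule ℝ (Tensor3 V) where
  carrier := {α | ∀ x y z, α (J x) (J y) z + α (J y) z (J x) + α z (J x) (J y) =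
    -(α x y z + α y z x + α z x y)}
  add_mem' := by
    intro α β hα hβ x y z
    simp only [LinearMap.add_apply]
    linarith [hα x y z, hβ x y z]
  zero_mem' := by simp
  smul_mem' := by
    intro c α hα x y z
    simp only [LinearMap.smul_apply, smul_eq_mul, ← mul_add, hα x y z, mul_neg]

variable {J : V →ₗ[ℝ] V} {g : V →ₗ[ℝ] V →ₗ[ℝ] ℝ}

theorem ghOne_le_diagonalInvariant : ghOne J ≤ diagonalInvariant J :=
  fun _ hα x z => by rw [hα.2, hα.2]

theorem ghThree_le_diagonalInvariant : ghThree g J ≤ diagonalInvariant J :=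
  fun _ hα x z => (hα.2.1 x x z).symm

theorem ghFour_le_diagonalInvariant (hJ : ∀ x, J (J x) = -x)
    (hg : ∀ x y, g (J x) (J y) = g x y) : ghFour g J ≤ diagonalInvariant J := by
  rintro α ⟨θ, hθ⟩ x z
  -- An orthogonal `J` with square -1 is skew for `g`.
  have h1 : ∀ y z, g (J y) z = -g y (J z) := fun y z => by
    rw [← hg y (J z), hJ, map_neg, neg_neg]
  rw [hθ, hθ]
  simp only [hJ, h1, map_neg]
  ring

/-- Polarizing α(x,x,z) = 0 makes α totally skew, so its cyclic sum is 3α and the sign comes from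
α(z,Jx,Jy) = -α(z,x,y). -/
theorem ghOne_le_cyclicAntiInvariant : ghOne J ≤ cyclicAntiInvariant J := by
  rintro α ⟨hα, h0⟩ x y z
  have h1 : ∀ x y z, α x y z = -α y x z := fun x y z => by
    have h := h0 (x + y) z
    simp only [map_add, LinearMap.add_apply, h0, zero_add, add_zero] at h
    linarith
  have h2 : ∀ x y z, α x y z = -α x z y := fun x y z => (hα x y z).1
  have h3 : ∀ x y z, α x y z = -α x (J y) (J z) := fun x y z => (hα x y z).2
  have h4 : ∀ x y z, α x y z = α z x y := fun x y z => by rw [h2, h1, neg_neg]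
  linarith [h4 (J x) (J y) z, h4 (J y) z (J x), h4 x y z, h4 y z x, h3 z x y]

theorem ghTwo_le_cyclicAntiInvariant : ghTwo J ≤ cyclicAntiInvariant J := by
  rintro α ⟨-, h⟩ x y z
  rw [h, h, neg_zero]

end GrayHervella

namespace IsInvariantAlmostHermitian

variable {Γ : Subgroup G3} {J : EndField}

/-! ### Obstructions -/

theorem diag_zero (h : IsInvariantAlmostHermitian Γ J) (i : Fin 6) : J 0 i i = 0 := by
  linarith [h.apply_swap i i]

theorem sum_sq_col (h : IsInvariantAlmostHermitian Γ J) (j : Fin 6) : ∑ i, J 0 i j ^ 2 = 1 := by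
  have := congrFun (congrFun h.transpose_mul_self j) j
  simpa [Matrix.mul_apply, ← pow_two] using this

theorem sum_sq_vecMul (h : IsInvariantAlmostHermitian Γ J) (q : E6) :
    ∑ j, (∑ i, q i * J 0 i j) ^ 2 = ∑ i, q i ^ 2 := by
  have h1 : dotProduct (Matrix.vecMul q (J 0)) (Matrix.vecMul q (J 0)) = dotProduct q q := by
    rw [← Matrix.dotProduct_mulVec, ← Matrix.mulVec_transpose (J 0) q, h.transpose_eq_neg,
      Matrix.neg_mulVec, Matrix.mulVec_neg, h.mulVec_mulVec, neg_neg]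
  simpa [dotProduct, Matrix.vecMul, ← pow_two] using h1

/-- The Nijenhuis tensor of an invariant orthogonal `J` is never totally skew-symmetric. -/
theorem not_nijenhuis_skew (h : IsInvariantAlmostHermitian Γ J)
    (hG : ∀ x z : E6, structureForm x z ((J 0).mulVec x) + structureForm x ((J 0).mulVec z) x
      - structureForm z ((J 0).mulVec x) x
      - structureForm ((J 0).mulVec x) ((J 0).mulVec z) ((J 0).mulVec x) = 0) : False := by
  have hd := h.diag_zero
  have hs := h.apply_swap
  have hc : ∀ i, (J 0).mulVec (Pi.single i 1) = fun k => J 0 k i := fun i => by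
    ext k; simp
  have hc' : ∀ i, (J 0).mulVec (fun k => J 0 k i) = -Pi.single i 1 := fun i => by
    rw [← hc, h.mulVec_mulVec]
  -- Take x = e_6 and z = Je_j, so Jz = -e_j. Since e_6 is central, only S(Je_j,Je_6,e_6) =
  -- S(Je_6,e_j,Je_6) survives.
  have key : ∀ j : Fin 6, J 0 4 5 * J 0 0 j + J 0 3 5 * J 0 2 j - J 0 2 5 * J 0 3 j
      - J 0 0 5 * J 0 4 j = (if j = 1 then J 0 0 5 * J 0 4 5 else 0)
        - (if j = 0 then J 0 1 5 * J 0 4 5 else 0) := by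
    intro j
    have h1 := hG (Pi.single 5 1) (fun k => J 0 k j)
    simp only [hc, hc', structureForm_apply, hd] at h1
    fin_cases j <;> simp at h1 ⊢ <;> linarith
  have hn := h.sum_sq_col 5
  -- The left side of `key` is the j-th entry of qJ for this row q, and |qJ| = |q|.
  have hq := h.sum_sq_vecMul ![J 0 4 5, 0, J 0 3 5, -J 0 2 5, -J 0 0 5, 0]
  have hrow : ∀ j : Fin 6, ∑ i, (![J 0 4 5, 0, J 0 3 5, -J 0 2 5, -J 0 0 5, 0] : E6) i * J 0 i j =
      (if j = 1 then J 0 0 5 * J 0 4 5 else 0) - (if j = 0 then J 0 1 5 * J 0 4 5 else 0) := by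
    intro j
    rw [← key j]
    simp [Fin.sum_univ_six]
    ring
  simp only [hrow] at hq
  simp [Fin.sum_univ_six, hd] at hq hn
  -- Eliminating `J 0 1 5` by means of |Je_6| = 1 leaves a vanishing sum of squares, whence Je_6 =
  -- ±e_2.
  have hz : J 0 0 5 ^ 2 + J 0 2 5 ^ 2 + J 0 3 5 ^ 2 + (J 0 4 5 ^ 2) ^ 2
      + (J 0 4 5 * J 0 2 5) ^ 2 + (J 0 4 5 * J 0 3 5) ^ 2 = 0 := by
    linear_combination -hq + J 0 4 5 ^ 2 * hn
  have e0 : J 0 0 5 = 0 := pow_eq_zero_iff two_ne_zero |>.mp (by nlinarith)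
  have e2 : J 0 2 5 = 0 := pow_eq_zero_iff two_ne_zero |>.mp (by nlinarith)
  have e3 : J 0 3 5 = 0 := pow_eq_zero_iff two_ne_zero |>.mp (by nlinarith)
  have e4 : J 0 4 5 = 0 :=
    pow_eq_zero_iff two_ne_zero |>.mp (pow_eq_zero_iff two_ne_zero |>.mp (by nlinarith))
  have e1 : J 0 1 5 ^ 2 = 1 := by
    simpa [e0, e2, e3, e4] using hn
  -- The unit column Je_2 already has the entry ±1 in position e_6, so its other entries vanish.
  have hn1 := h.sum_sq_col 1
  have f5 : J 0 5 1 = -J 0 1 5 := hs 5 1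
  simp only [Fin.sum_univ_six, hd, f5] at hn1
  have z0 : J 0 0 1 = 0 := by nlinarith
  have z2 : J 0 2 1 = 0 := by nlinarith
  have z3 : J 0 3 1 = 0 := by nlinarith
  have z4 : J 0 4 1 = 0 := by nlinarith
  have h1 : (J 0).mulVec (Pi.single 1 1) = J 0 1 5 • -Pi.single 5 1 := by
    rw [hc]
    ext k
    fin_cases k <;> simp [z0, z2, z3, z4, f5, hd]
  -- Take z = e_2: Jz is a multiple of the central vector e_6, so the two terms containing Jz drop
  -- out.
  have hx : ∀ x : E6, x 0 * (J 0).mulVec x 4 + x 4 * (J 0).mulVec x 0 = 0 := by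
    intro x
    have h2 := hG x (Pi.single 1 1)
    rw [h1] at h2
    simp [structureForm_apply] at h2
    linarith
  have r4 : J 0 0 4 = 0 := by
    simpa [hc] using hx (Pi.single 4 1)
  have r2 : J 0 0 2 = 0 := by
    have h2 := hx (Pi.single 4 1 + Pi.single 2 1)
    rw [Matrix.mulVec_add, hc, hc] at h2
    simpa [Pi.add_apply, r4] using h2
  have r3 : J 0 0 3 = 0 := by
    have h2 := hx (Pi.single 4 1 + Pi.single 3 1)
    rw [Matrix.mulVec_add, hc, hc] at h2
    simpa [Pi.add_apply, r4] using h2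
  -- Every entry of Je_1 is now zero, although its norm is 1.
  have hn0 := h.sum_sq_col 0
  simp [Fin.sum_univ_six, hd, hs _ 0, z0, r2, r3, r4, e0] at hn0

/-- The cyclic sum of `∇ω`, up to sign. -/
def cyclicForm (J : EndField) (x y z : E6) : ℝ :=
  structureForm x y ((J 0).mulVec z) + structureForm y z ((J 0).mulVec x)
    + structureForm z x ((J 0).mulVec y)

/-- The differential of the fundamental form of an invariant orthogonal `J` is never of type
`(3, 0) + (0, 3)`. -/
theorem not_cyclicForm_antiInvariant (h : IsInvariantAlmostHermitian Γ J)
    (hH : ∀ x y z : E6, cyclicForm J ((J 0).mulVec x) ((J 0).mulVec y) z = -cyclicForm J x y z) :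
    False := by
  have hd := h.diag_zero
  have hs := h.apply_swap
  have hc : ∀ i, (J 0).mulVec (Pi.single i 1) = fun k => J 0 k i := fun i => by
    ext k; simp
  have h5 : ∀ x y, cyclicForm J x y (Pi.single 5 1) = (x 0 * y 1 - x 1 * y 0) * J 0 4 5 := by
    intro x y
    simp [cyclicForm, structureForm_apply, hc, hd]
  -- By `h5`, contraction with e_6 gives a multiple of e^1∧e^2. If the factor were nonzero,
  -- (e^1∧e^2)(Je_1,Je_2) would be -1, but skewness of `J 0` makes it the square of `J 0 0 1`.
  have e4 : J 0 4 5 = 0 := by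
    by_contra hne
    have h1 := hH (Pi.single 0 1) (Pi.single 1 1) (Pi.single 5 1)
    rw [h5, h5, ← neg_mul] at h1
    have h2 := mul_right_cancel₀ hne h1
    simp [hc, hd, hs 1 0] at h2
    nlinarith
  -- The kernel contains e_6, and the type condition makes the kernel `J`-stable.
  have hu : ∀ y z, cyclicForm J (fun k => J 0 k 5) y z = 0 := by
    intro y z
    have h1 := hH (Pi.single 5 1) ((J 0).mulVec y) z
    have h2 : cyclicForm J (Pi.single 5 1) ((J 0).mulVec y) z =
        cyclicForm J ((J 0).mulVec y) z (Pi.single 5 1) := by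
      simp only [cyclicForm]
      ring
    rw [h2, h5, e4, mul_zero, h.mulVec_mulVec, hc] at h1
    simp only [cyclicForm, Matrix.mulVec_neg, map_neg, LinearMap.neg_apply] at h1 ⊢
    linarith
  have hc' : ∀ i, (J 0).mulVec (fun k => J 0 k i) = -Pi.single i 1 := fun i => by
    rw [← hc, h.mulVec_mulVec]
  -- With u = Je_6 and Ju = -e_6, the pair (e_3,e_4) gives u_3² + u_4² = 1 and the pair (e_1,e_5)
  -- gives u_1² = 1. This contradicts |u| = 1.
  have h1 := hu (Pi.single 2 1) (Pi.single 3 1)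
  have h2 := hu (Pi.single 0 1) (Pi.single 4 1)
  have hn := h.sum_sq_col 5
  simp [cyclicForm, structureForm_apply, hc, hc', hd, hs 5, Fin.sum_univ_six, e4] at h1 h2 hn
  nlinarith [sq_nonneg (J 0 1 5)]

/-! ### Passage from the obstructions to the Gray-Hervella classes and to closed ω -/

theorem nablaOmega_cyclic_zero (h : IsInvariantAlmostHermitian Γ J) (x y z : E6) :
    tensorOfComponents (nablaOmega J 0) x y z + tensorOfComponents (nablaOmega J 0) y z x
      + tensorOfComponents (nablaOmega J 0) z x y = -cyclicForm J x y z := by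
  simp only [h.nablaOmega_tensor_zero, cyclicForm]
  linarith [structureForm_swap x y ((J 0).mulVec z), structureForm_swap y z ((J 0).mulVec x),
    structureForm_swap z x ((J 0).mulVec y), structureForm_swap x ((J 0).mulVec y) z,
    structureForm_swap y ((J 0).mulVec z) x, structureForm_swap z ((J 0).mulVec x) y,
    structureForm_swap x ((J 0).mulVec z) y, structureForm_swap y ((J 0).mulVec x) z,
    structureForm_swap z ((J 0).mulVec y) x]

/-- For α = ∇ω, the difference α(x,x,z) - α(Jx,Jx,z) equals g(N(x,z),Jx). -/
theorem not_mem_diagonalInvariant (h : IsInvariantAlmostHermitian Γ J) :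
    tensorOfComponents (nablaOmega J 0) ∉ diagonalInvariant (J 0).mulVecLin := by
  intro hmem
  refine h.not_nijenhuis_skew fun x z => ?_
  have h1 := hmem x z
  simp only [Matrix.mulVecLin_apply, h.nablaOmega_tensor_zero, h.mulVec_mulVec, map_neg,
    LinearMap.neg_apply] at h1
  linarith [structureForm_swap x x ((J 0).mulVec z),
    structureForm_swap ((J 0).mulVec x) ((J 0).mulVec x) ((J 0).mulVec z),
    structureForm_swap x ((J 0).mulVec x) z,
    structureForm_swap z ((J 0).mulVec x) x, structureForm_swap z x ((J 0).mulVec x)]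

theorem not_mem_cyclicAntiInvariant (h : IsInvariantAlmostHermitian Γ J) :
    tensorOfComponents (nablaOmega J 0) ∉ cyclicAntiInvariant (J 0).mulVecLin := by
  intro hmem
  refine h.not_cyclicForm_antiInvariant fun x y z => ?_
  have h1 := hmem x y z
  simp only [Matrix.mulVecLin_apply] at h1
  rw [h.nablaOmega_cyclic_zero, h.nablaOmega_cyclic_zero] at h1
  linarith

theorem ghSpace_sup_le_diagonalInvariant (h : IsInvariantAlmostHermitian Γ J) :
    ⨆ i ∈ ({1, 3, 4} : Finset ℕ), ghSpace (metricForm 0) (J 0).mulVecLin i ≤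
      diagonalInvariant (J 0).mulVecLin := by
  refine iSup₂_le fun i hi => ?_
  simp only [Finset.mem_insert, Finset.mem_singleton] at hi
  rcases hi with rfl | rfl | rfl
  · exact ghOne_le_diagonalInvariant
  · exact ghThree_le_diagonalInvariant
  · exact ghFour_le_diagonalInvariant h.mulVec_mulVec (h.orthogonal 0)

theorem ghSpace_sup_le_cyclicAntiInvariant :
    ⨆ i ∈ ({1, 2} : Finset ℕ), ghSpace (metricForm 0) (J 0).mulVecLin i ≤
      cyclicAntiInvariant (J 0).mulVecLin := by
  refine iSup₂_le fun i hi => ?_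
  simp only [Finset.mem_insert, Finset.mem_singleton] at hi
  rcases hi with rfl | rfl
  · exact ghOne_le_cyclicAntiInvariant
  · exact ghTwo_le_cyclicAntiInvariant

theorem not_isSymplecticStructure (h : IsInvariantAlmostHermitian Γ J) :
    ¬ IsSymplecticStructure J := by
  intro hJ
  -- In the cyclic sum the Christoffel terms cancel in pairs, by symmetry of Γ and skewness of ω,
  -- and only dω remains.
  have hcomp : ∀ i j k,
      nablaOmega J 0 i j k + nablaOmega J 0 j k i + nablaOmega J 0 k i j = 0 := by
    intro i j k
    have h1 := hJ 0 i j k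
    have hΓ : ∀ k i j, christoffel 0 k i j = christoffel 0 k j i := fun k i j => by
      rw [christoffel_zero, christoffel_zero]
      ring
    have hω : ∀ j k, fundamentalForm J 0 j k = -fundamentalForm J 0 k j := fun j k => by
      rw [h.fundamentalForm_eq, coframe_zero]
      simp [h.apply_swap j k]
    have h2 : ∀ i j k, ∑ l, christoffel 0 l i j * fundamentalForm J 0 l k =
        -∑ l, christoffel 0 l j i * fundamentalForm J 0 k l := fun i j k => by
      rw [← Finset.sum_neg_distrib]
      refine Finset.sum_congr rfl fun l _ => ?_
      rw [hΓ, hω]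
      ring
    simp only [nablaOmega]
    linarith [h2 i j k, h2 j k i, h2 k i j]
  have hcyc : ∀ x y z, cyclicForm J x y z = 0 := by
    intro x y z
    have h1 := h.nablaOmega_cyclic_zero x y z
    -- The cyclic permutations are moved from the arguments to the indices, so that `hcomp` applies
    -- to each coefficient.
    rw [← tensorOfComponents_swap_right _ y x z,
      ← tensorOfComponents_swap_left _ x y z, ← tensorOfComponents_swap_left _ x z y,
      ← tensorOfComponents_swap_right _ x y z] at h1
    simp only [tensorOfComponents_apply, ← Finset.sum_add_distrib, ← add_mul, hcomp] at h1
    simpa using h1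
  refine h.not_cyclicForm_antiInvariant fun x y z => ?_
  rw [hcyc, hcyc, neg_zero]

end IsInvariantAlmostHermitian

/-! ### The Nijenhuis tensor on left-invariant vector fields -/

theorem contDiff_leftDeriv_mulVec (y : E6) : ContDiff ℝ ∞ fun q => (leftDeriv q).mulVec y := by
  rw [contDiff_pi]
  intro i
  fin_cases i <;> simp [leftDeriv, Matrix.mulVec, dotProduct, Fin.sum_univ_six] <;> fun_prop

theorem leftDeriv_zero : leftDeriv 0 = 1 := by
  ext i j
  fin_cases i <;> fin_cases j <;> simp [leftDeriv]

theorem fderiv_leftDeriv_mulVec_zero (y v : E6) :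
    fderiv ℝ (fun q => (leftDeriv q).mulVec y) 0 v =
      ![0, 0, 0, 0, -(v 0 * y 1), -(v 0 * y 4) - v 2 * y 3] := by
  have hp : ∀ i : Fin 6, HasFDerivAt (fun q : E6 => q i)
      (ContinuousLinearMap.proj (R := ℝ) (φ := fun _ : Fin 6 => ℝ) i) 0 :=
    fun i => (ContinuousLinearMap.proj (R := ℝ) (φ := fun _ : Fin 6 => ℝ) i).hasFDerivAt
  have h : HasFDerivAt (fun q => (leftDeriv q).mulVec y) (ContinuousLinearMap.pi
      (![0, 0, 0, 0, -(y 1 • ContinuousLinearMap.proj 0),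
        -(y 4 • ContinuousLinearMap.proj 0) - y 3 • ContinuousLinearMap.proj 2] :
        Fin 6 → E6 →L[ℝ] ℝ)) 0 := by
    rw [hasFDerivAt_pi]
    have h4 := ((hp 0).mul_const (y 1)).neg.add_const (y 4)
    have h5 := (((((hp 0).pow 2).mul_const (y 1 / 2)).sub ((hp 2).mul_const (y 3))).sub
      ((hp 0).mul_const (y 4))).add_const (y 5)
    intro i
    fin_cases i
    · simpa [leftDeriv, Matrix.mulVec, dotProduct, Fin.sum_univ_six] using hasFDerivAt_const _ _
    · simpa [leftDeriv, Matrix.mulVec, dotProduct, Fin.sum_univ_six] using hasFDerivAt_const _ _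
    · simpa [leftDeriv, Matrix.mulVec, dotProduct, Fin.sum_univ_six] using hasFDerivAt_const _ _
    · simpa [leftDeriv, Matrix.mulVec, dotProduct, Fin.sum_univ_six] using hasFDerivAt_const _ _
    · convert h4 using 1
      · ext q
        simp [leftDeriv, Matrix.mulVec, dotProduct, Fin.sum_univ_six]
      · rfl
    · convert h5 using 1
      · ext q
        simp [leftDeriv, Matrix.mulVec, dotProduct, Fin.sum_univ_six]
        ring
      · ext v
        simp
        ring
  rw [h.fderiv]
  ext i
  fin_cases i <;> simp <;> ring

/-- The fields q ↦ `leftDeriv q` x are left-invariant. This links S, defined from the coframe, to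
the bracket that enters the Nijenhuis tensor. -/
theorem structureForm_eq_lieBracket (x y z : E6) :
    structureForm x y z = -dotProduct (VectorField.lieBracket ℝ
      (fun q => (leftDeriv q).mulVec x) (fun q => (leftDeriv q).mulVec y) 0) z := by
  rw [VectorField.lieBracket, fderiv_leftDeriv_mulVec_zero, fderiv_leftDeriv_mulVec_zero,
    structureForm_apply]
  simp [leftDeriv_zero, dotProduct, Fin.sum_univ_six]
  ring

theorem IsInvariantAlmostHermitian.not_isComplexStructure {Γ : Subgroup G3} {J : EndField}
    (h : IsInvariantAlmostHermitian Γ J) : ¬ IsComplexStructure J := by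
  intro hJ
  refine h.not_nijenhuis_skew fun x z => ?_
  have h1 := hJ _ _ (contDiff_leftDeriv_mulVec x) (contDiff_leftDeriv_mulVec z) 0
  have hL : ∀ x, (fun q => (J q).mulVec ((leftDeriv q).mulVec x)) =
      fun q => (leftDeriv q).mulVec ((J 0).mulVec x) := fun x => by
    ext1 q
    rw [Matrix.mulVec_mulVec, Matrix.mulVec_mulVec, h.mul_leftDeriv]
  rw [hL, hL] at h1
  have hA : ∀ v w : E6, dotProduct ((J 0).mulVec v) w = -dotProduct v ((J 0).mulVec w) := by
    intro v w
    rw [Matrix.dotProduct_mulVec, ← Matrix.mulVec_transpose, h.transpose_eq_neg,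
      Matrix.neg_mulVec, neg_dotProduct, neg_neg]
  -- Pairing N(x,z) = 0 with Jx gives the expression excluded by `not_nijenhuis_skew`.
  have h2 := congrArg (fun v => dotProduct v ((J 0).mulVec x)) h1
  simp only [sub_dotProduct, hA, zero_dotProduct, h.mulVec_mulVec, dotProduct_neg] at h2
  have hS := structureForm_eq_lieBracket
  linarith [hS ((J 0).mulVec x) ((J 0).mulVec z) ((J 0).mulVec x),
    hS ((J 0).mulVec x) z x, hS x ((J 0).mulVec z) x, hS x z ((J 0).mulVec x),
    structureForm_swap z ((J 0).mulVec x) x]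

/-! ### The main theorem -/

theorem ghClass_mono (Γ : Subgroup G3) {S T : Finset ℕ} (hST : S ⊆ T) :
    ghClass Γ S ⊆ ghClass Γ T :=
  fun _ hJ => ⟨hJ.1, fun p => SetLike.le_def.mp (biSup_mono fun _ hi => hST hi) (hJ.2 p)⟩

theorem ghClass_one_three_four (Γ : Subgroup G3) : ghClass Γ {1, 3, 4} = ∅ :=
  Set.eq_empty_of_forall_notMem fun _ hJ =>
    hJ.1.1.not_mem_diagonalInvariant (hJ.1.1.ghSpace_sup_le_diagonalInvariant (hJ.2 0))

theorem ghClass_one_two (Γ : Subgroup G3) : ghClass Γ {1, 2} = ∅ :=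
  Set.eq_empty_of_forall_notMem fun _ hJ => hJ.1.1.not_mem_cyclicAntiInvariant
    (IsInvariantAlmostHermitian.ghSpace_sup_le_cyclicAntiInvariant (hJ.2 0))

end
theorem corollary3 (Γ : Subgroup G3) [DiscreteTopology Γ]
    [CompactSpace (Quotient (QuotientGroup.rightRel Γ))] :
    ghClass Γ {1} = ∅ ∧ ghClass Γ {2} = ∅ ∧ ghClass Γ {3} = ∅ ∧ ghClass Γ {4} = ∅ ∧
    ghClass Γ {1, 2} = ∅ ∧ ghClass Γ {1, 3} = ∅ ∧ ghClass Γ {1, 4} = ∅ ∧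
    ghClass Γ {3, 4} = ∅ ∧ ghClass Γ {1, 3, 4} = ∅ ∧
    (¬ ∃ J, IsInvariantAlmostHermitian Γ J ∧ IsComplexStructure J) ∧
    (¬ ∃ J, IsInvariantAlmostHermitian Γ J ∧ IsSymplecticStructure J) := by
  have h134 : ∀ S : Finset ℕ, S ⊆ {1, 3, 4} → ghClass Γ S = ∅ := fun S hS =>
    Set.subset_empty_iff.mp (ghClass_one_three_four Γ ▸ ghClass_mono Γ hS)
  have h12 : ∀ S : Finset ℕ, S ⊆ {1, 2} → ghClass Γ S = ∅ := fun S hS =>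
    Set.subset_empty_iff.mp (ghClass_one_two Γ ▸ ghClass_mono Γ hS)
  exact ⟨h134 _ (by decide), h12 _ (by decide), h134 _ (by decide), h134 _ (by decide),
    h12 _ (by decide), h134 _ (by decide), h134 _ (by decide), h134 _ (by decide),
    h134 _ (by decide), fun ⟨_, hJ, hC⟩ => hJ.not_isComplexStructure hC,
    fun ⟨_, hJ, hC⟩ => hJ.not_isSymplecticStructure hC⟩
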